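/- Let $A$ be a unital (complex) C*-algebra of real rank zero, i.e. the invertible selfadjoint elements of $A$ are norm-dense in the set of all selfadjoint elements of $A$. Suppose that every non-zero projection $p=p^*=p^2$ in $A$ is properly infinite, i.e. there are mutually orthogonal projections $e,f\in A$ with $e\le p$, $f\le p$ and elements $v,w\in A$ with $v^*v=p=w^*w$, $vv^*=e$, $ww^*=f$. Let $B$ be a unital complex Banach algebra which is semisimple, i.e. whose Jacobson radical is zero. Let $T\colon A\to B$ be a surjective linear mapping which is spectrally bounded, i.e. there is a constant $M\ge 0$ such that $r(Tx)\le M\,r(x)$ for all $x\in A$, where $r$ denotes the spectral radius. Then $T1$ is an invertible element of the centre of $B$. -/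

import Mathlib

namespace SpBdd

/-- A linear map `T` between complex algebras is spectrally bounded if there is a constant `M ≥ 0`
such that `r(T x) ≤ M r(x)` for all `x`, where `r` is the spectral radius. -/
def IsSpectrallyBounded {A B : Type*} [NormedRing A] [NormedAlgebra ℂ A]
    [NormedRing B] [NormedAlgebra ℂ B] (T : A →ₗ[ℂ] B) : Prop :=
  ∃ M : NNReal, ∀ x : A, spectralRadius ℂ (T x) ≤ (M : ENNReal) * spectralRadius ℂ x

/-- A unital C⋆-algebra has real rank zero if its invertible selfadjoint elements are
(norm-)dense in the set of all selfadjoint elements. -/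
def RealRankZero (A : Type*) [CStarAlgebra A] : Prop :=
  Dense {a : selfAdjoint A | IsUnit (a : A)}

/-- Murray–von Neumann equivalence: `p = v⋆ v` and `q = v v⋆` for some `v` in the algebra. -/
def MvNEquiv {A : Type*} [CStarAlgebra A] (p q : A) : Prop :=
  ∃ v : A, star v * v = p ∧ v * star v = q

/-- `p` is a properly infinite projection: it is a non-zero projection and there are two mutually
orthogonal subprojections `e`, `f` of `p`, each Murray–von Neumann equivalent to `p`.
For projections, `e ≤ p` means `p * e = e`. -/
def IsProperlyInfinite {A : Type*} [CStarAlgebra A] (p : A) : Prop :=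
  IsStarProjection p ∧ p ≠ 0 ∧
    ∃ e f : A, IsStarProjection e ∧ IsStarProjection f ∧
      p * e = e ∧ p * f = f ∧ e * f = 0 ∧ MvNEquiv p e ∧ MvNEquiv p f

/-- An algebra is semisimple (in the sense of Banach algebra theory) if its Jacobson radical, the
intersection of its maximal left ideals, is zero. -/
def HasZeroRadical (B : Type*) [Ring B] : Prop :=
  Ring.jacobson B = ⊥

end SpBdd

/-! The argument passes through square-zero elements, of which `A` has many.

Analytic half: if `a * a = 0` then `T a * T a = 0`. Put `b = T a`. For large `c` the spectrum of `(y
+ c) b` is controlled by that of `T` at a small perturbation of `c a`, whose spectral radius is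
small because `a² = 0`. So `c ↦ r((y + c) b)` is bounded, and Liouville's theorem for the spectral
radius gives `r((y + c) b) ≤ r(y b)`. A second use of Liouville gives `r(y (1 - c b) b) ≤ r(y b)`.
Dividing by `c` and letting `c → ∞` yields `r(y b²) = 0` for every `y`, so `b²` lies in the radical,
which is zero (`map_mul_map_eq_zero_of_mul_self_eq_zero`).

Algebraic half: proper infiniteness makes each corner `p A p` the span of its square-zero elements
(`corner_subset_span_squareZero`), so `T` sends orthogonal corners to elements that anticommute.
Testing on idempotents, which span `A`, gives `2 (Tx Ty + Ty Tx) = T1 T(xy + yx) + T(xy + yx) T1`,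
and `(T1)²` central. As `1` is in the range of `T`, Jordan multiplication by `T1` is onto, and
`isUnit_and_central_of_jordan_mul_surjective` concludes. -/

open Filter Topology Bornology

/-! ### Maximum principle and Liouville theorem for the spectral radius. -/

section SpectralBound

variable {B : Type*} [NormedRing B] [NormedAlgebra ℂ B]

/-- The spectrum of `x` lies in the closed disc of radius `s` about the origin. -/
def SpectrumBound (x : B) (s : ℝ) : Prop := ∀ z ∈ spectrum ℂ x, ‖z‖ ≤ s

theorem SpectrumBound.mono {x : B} {s t : ℝ} (h : SpectrumBound x s) (hst : s ≤ t) :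
    SpectrumBound x t := fun z hz => (h z hz).trans hst

theorem SpectrumBound.of_forall_gt {x : B} {s : ℝ} (h : ∀ t, s < t → SpectrumBound x t) :
    SpectrumBound x s := fun z hz => le_of_forall_gt_imp_ge_of_dense fun t ht => h t ht z hz

theorem SpectrumBound.spectralRadius_le {x : B} {s : ℝ} (h : SpectrumBound x s) :
    spectralRadius ℂ x ≤ ENNReal.ofReal s :=
  iSup₂_le fun z hz => by
    rw [← enorm_eq_nnnorm, ← ofReal_norm z]
    exact ENNReal.ofReal_le_ofReal (h z hz)

theorem exists_spectrumBound [CompleteSpace B] (x : B) : ∃ s : ℝ, 0 ≤ s ∧ SpectrumBound x s :=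
  ⟨‖x‖ * ‖(1 : B)‖, by positivity, fun _ hz => spectrum.norm_le_norm_mul_of_mem hz⟩

theorem SpectrumBound.pow {x : B} {s : ℝ} (h : SpectrumBound x s) {n : ℕ} (hn : 0 < n) :
    SpectrumBound (x ^ n) (s ^ n) := by
  intro z hz
  rw [spectrum.map_pow_of_pos x hn] at hz
  obtain ⟨w, hw, rfl⟩ := hz
  simpa using pow_le_pow_left₀ (norm_nonneg _) (h w hw) n

theorem SpectrumBound.of_pow {x : B} {s : ℝ} (hs : 0 ≤ s) {n : ℕ} (hn : n ≠ 0)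
    (h : SpectrumBound (x ^ n) (s ^ n)) : SpectrumBound x s := by
  intro z hz
  have := h (z ^ n) (spectrum.pow_mem_pow x n hz)
  rw [norm_pow] at this
  exact le_of_pow_le_pow_left₀ hn hs this

theorem SpectrumBound.smul {x : B} {s : ℝ} (h : SpectrumBound x s) (c : ℂ) (hc : c ≠ 0) :
    SpectrumBound (c • x) (‖c‖ * s) := by
  intro z hz
  have := spectrum.unit_smul_eq_smul x (Units.mk0 c hc)
  rw [show c • x = Units.mk0 c hc • x from rfl, this] at hz
  obtain ⟨w, hw, rfl⟩ := hz
  show ‖c * w‖ ≤ _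
  rw [norm_mul]
  exact mul_le_mul_of_nonneg_left (h w hw) (norm_nonneg _)

variable [CompleteSpace B]

/-- Gelfand's formula, upper estimate. -/
theorem SpectrumBound.eventually_norm_pow_lt {x : B} {s t : ℝ} (h : SpectrumBound x s)
    (hst : s < t) (ht : 0 < t) : ∀ᶠ n : ℕ in atTop, ‖x ^ n‖ < t ^ n := by
  have h1 : spectralRadius ℂ x < ENNReal.ofReal t :=
    h.spectralRadius_le.trans_lt ((ENNReal.ofReal_lt_ofReal_iff ht).2 hst)
  filter_upwards [(spectrum.pow_norm_pow_one_div_tendsto_nhds_spectralRadius x).eventually_lt_const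
    h1, eventually_gt_atTop 0] with n hn hn0
  rw [ENNReal.ofReal_lt_ofReal_iff ht] at hn
  have h2 := pow_lt_pow_left₀ hn (by positivity) hn0.ne'
  rwa [← Real.rpow_natCast, ← Real.rpow_mul (norm_nonneg _), one_div,
    inv_mul_cancel₀ (by exact_mod_cast hn0.ne'), Real.rpow_one] at h2

/-- Gelfand's formula, lower estimate. -/
theorem SpectrumBound.of_frequently_norm_pow_le {x : B} {s : ℝ} (hs : 0 < s)
    (h : ∃ᶠ n : ℕ in atTop, ‖x ^ n‖ ≤ s ^ n) : SpectrumBound x s := by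
  intro z hz
  by_contra! hlt
  have h1 : 1 < ‖z‖ / s := (one_lt_div hs).2 hlt
  obtain ⟨n, hn, hn'⟩ := (h.and_eventually
    ((tendsto_pow_atTop_atTop_of_one_lt h1).eventually_gt_atTop ‖(1 : B)‖)).exists
  have h2 := spectrum.norm_le_norm_mul_of_mem (spectrum.pow_mem_pow x n hz)
  rw [norm_pow] at h2
  rw [div_pow, lt_div_iff₀ (by positivity)] at hn'
  have := mul_le_mul_of_nonneg_right hn (norm_nonneg (1 : B))
  nlinarith

/-- Along the exponents `2 ^ k` the estimate persists under squaring, and for fixed `k` it is an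
open condition; compactness then makes Gelfand's formula uniform. -/
theorem exists_norm_pow_two_pow_lt {X : Type*} [TopologicalSpace X] {K : Set X} (hK : IsCompact K)
    {f : X → B} (hf : ContinuousOn f K) {s t : ℝ} (hst : s < t) (ht : 0 < t)
    (h : ∀ x ∈ K, SpectrumBound (f x) s) :
    ∃ k₀ : ℕ, ∀ x ∈ K, ∀ k ≥ k₀, ‖f x ^ 2 ^ k‖ < t ^ 2 ^ k := by
  refine hK.induction_on (p := fun S => ∃ k₀ : ℕ, ∀ x ∈ S, ∀ k ≥ k₀, ‖f x ^ 2 ^ k‖ < t ^ 2 ^ k)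
    ⟨0, by simp⟩ (fun S S' hSS' ⟨k, hk⟩ => ⟨k, fun x hx => hk x (hSS' hx)⟩) ?_ ?_
  · rintro S S' ⟨k, hk⟩ ⟨k', hk'⟩
    refine ⟨max k k', ?_⟩
    rintro x (hx | hx) j hj
    · exact hk x hx j (le_of_max_le_left hj)
    · exact hk' x hx j (le_of_max_le_right hj)
  · intro x hx
    have h1 : Tendsto (fun k : ℕ => 2 ^ k) atTop atTop :=
      tendsto_pow_atTop_atTop_of_one_lt one_lt_two
    obtain ⟨k₀, hk₀⟩ := (h1.eventually ((h x hx).eventually_norm_pow_lt hst ht)).exists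
    have h2 : ContinuousWithinAt (fun y => ‖f y ^ 2 ^ k₀‖) K x := ((hf x hx).pow _).norm
    refine ⟨{y | ‖f y ^ 2 ^ k₀‖ < t ^ 2 ^ k₀}, h2.eventually_lt_const hk₀, k₀, ?_⟩
    intro y hy k hk
    induction k, hk using Nat.le_induction with
    | base => exact hy
    | succ k hk ih =>
      rw [pow_succ 2 k, pow_mul, pow_mul, pow_two, pow_two]
      exact (norm_mul_le _ _).trans_lt (mul_lt_mul'' ih ih (norm_nonneg _) (norm_nonneg _))

/-- Maximum principle for the spectral radius of an analytic function. -/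
theorem SpectrumBound.of_forall_mem_frontier {U : Set ℂ} (hU : IsBounded U) {f : ℂ → B}
    (hf : DiffContOnCl ℂ f U) {s : ℝ} (hs : 0 ≤ s) (h : ∀ z ∈ frontier U, SpectrumBound (f z) s)
    {z : ℂ} (hz : z ∈ closure U) : SpectrumBound (f z) s := by
  refine SpectrumBound.of_forall_gt fun t hst => ?_
  have ht : 0 < t := hs.trans_lt hst
  have hK : IsCompact (frontier U) :=
    hU.isCompact_closure.of_isClosed_subset isClosed_frontier frontier_subset_closure
  obtain ⟨k₀, hk₀⟩ :=
    exists_norm_pow_two_pow_lt hK (hf.continuousOn.mono frontier_subset_closure) hst ht h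
  have h1 : Tendsto (fun k : ℕ => 2 ^ k) atTop atTop :=
    tendsto_pow_atTop_atTop_of_one_lt one_lt_two
  refine SpectrumBound.of_frequently_norm_pow_le ht
    (h1.frequently (Eventually.frequently ?_))
  filter_upwards [eventually_ge_atTop k₀] with k hk
  have hd : DiffContOnCl ℂ (fun z => f z ^ 2 ^ k) U :=
    ⟨hf.differentiableOn.pow _, hf.continuousOn.pow _⟩
  exact Complex.norm_le_of_forall_mem_frontier_norm_le hU hd (fun w hw => (hk₀ w hw k hk).le) hz

/-- Upper semicontinuity of the spectral radius: one good power `m` stays good nearby, and its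
multiples suffice for Gelfand's lower estimate. -/
theorem SpectrumBound.eventually_nhds {f : ℂ → B} {z₀ : ℂ} (hf : ContinuousAt f z₀)
    {s t : ℝ} (h : SpectrumBound (f z₀) s) (hst : s < t) (ht : 0 < t) :
    ∀ᶠ z in 𝓝 z₀, SpectrumBound (f z) t := by
  obtain ⟨m, hm⟩ := ((h.eventually_norm_pow_lt hst ht).and (eventually_gt_atTop 0)).exists
  have h2 : ContinuousAt (fun z => ‖f z ^ m‖) z₀ := (hf.pow _).norm
  filter_upwards [h2.eventually_lt_const hm.1] with z hz
  refine SpectrumBound.of_frequently_norm_pow_le ht ?_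
  have h1 : Tendsto (fun k : ℕ => m * (k + 1)) atTop atTop :=
    tendsto_atTop_mono (fun k => by
      have := Nat.mul_le_mul hm.2 (le_refl (k + 1)); simp only [id]; omega) tendsto_id
  refine h1.frequently (Frequently.of_forall fun k => ?_)
  rw [pow_mul, pow_mul]
  refine (norm_pow_le' _ (Nat.succ_pos k)).trans ?_
  gcongr

theorem frontier_annulus_subset (σ ρ : ℝ) :
    frontier {z : ℂ | σ < ‖z‖ ∧ ‖z‖ < ρ} ⊆ {z | ‖z‖ = σ ∨ ‖z‖ = ρ} ∧
    closure {z : ℂ | σ < ‖z‖ ∧ ‖z‖ < ρ} ⊆ {z | σ ≤ ‖z‖} := by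
  have ho : IsOpen {z : ℂ | σ < ‖z‖ ∧ ‖z‖ < ρ} :=
    (isOpen_lt continuous_const continuous_norm).inter (isOpen_lt continuous_norm continuous_const)
  have hc : closure {z : ℂ | σ < ‖z‖ ∧ ‖z‖ < ρ} ⊆ {z | σ ≤ ‖z‖ ∧ ‖z‖ ≤ ρ} :=
    closure_minimal (fun z hz => ⟨hz.1.le, hz.2.le⟩)
      ((isClosed_le continuous_const continuous_norm).inter
        (isClosed_le continuous_norm continuous_const))
  refine ⟨fun z hz => ?_, fun z hz => (hc hz).1⟩
  rw [ho.frontier_eq] at hz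
  have h1 := hc hz.1
  have h2 := hz.2
  by_contra h3
  rw [Set.mem_ofPred_eq, not_or] at h3
  exact h2 ⟨lt_of_le_of_ne h1.1 (Ne.symm h3.1), lt_of_le_of_ne h1.2 h3.2⟩

/-- Liouville's theorem for the spectral radius of an entire function. -/
theorem SpectrumBound.liouville {f : ℂ → B} (hf : Differentiable ℂ f) {R s : ℝ}
    (hR : ∀ z, SpectrumBound (f z) R) {z₀ : ℂ} (h0 : SpectrumBound (f z₀) s) (hs : 0 ≤ s) (z₁ : ℂ) :
    SpectrumBound (f z₁) s := by
  rcases eq_or_ne z₁ z₀ with rfl | hne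
  · exact h0
  set g : ℂ → B := fun w => f (z₀ + w * (z₁ - z₀)) with hg
  have hgd : Differentiable ℂ g := by
    intro w
    exact (hf _).comp w (by fun_prop)
  have hg0 : SpectrumBound (g 0) s := by simpa [hg] using h0
  have hg1 : g 1 = f z₁ := by simp [hg]
  rw [← hg1]
  have hgR : ∀ w, SpectrumBound (g w) (max R 1) := fun w => (hR _).mono (le_max_left _ _)
  clear_value g
  refine SpectrumBound.of_forall_gt fun t hst => ?_
  have ht : 0 < t := hs.trans_lt hst
  obtain ⟨δ, hδ, hball⟩ := Metric.eventually_nhds_iff.1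
    (hg0.eventually_nhds hgd.continuous.continuousAt hst ht)
  set σ : ℝ := min (δ / 2) (1 / 2)
  have hσ0 : 0 < σ := by positivity
  have hσδ : σ < δ := (min_le_left _ _).trans_lt (by linarith)
  have hσ1 : σ < 1 := (min_le_right _ _).trans_lt (by norm_num)
  -- the bound `r (g 1) ^ q ≤ t ^ q / σ`
  have key : ∀ q : ℕ, 0 < q → SpectrumBound (g 1 ^ q) (t ^ q / σ) := by
    intro q hq
    -- The maximum principle is applied to `z⁻¹ • g z ^ q` on an annulus around `1`. The inner
    -- circle contributes `t ^ q / σ`; `ρ` is so large that the outer one contributes no more.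
    set ρ : ℝ := max 2 (max R 1 ^ q / (t ^ q / σ))
    have hρ2 : 2 ≤ ρ := le_max_left _ _
    set U : Set ℂ := {z : ℂ | σ < ‖z‖ ∧ ‖z‖ < ρ}
    have hUb : IsBounded U :=
      (Metric.isBounded_ball (x := (0 : ℂ)) (r := ρ)).subset fun z hz => by
        simpa using hz.2
    obtain ⟨hfr, hcl⟩ := frontier_annulus_subset σ ρ
    have hne0 : ∀ z ∈ closure U, z ≠ 0 := fun z hz => norm_pos_iff.1 (hσ0.trans_le (hcl hz))
    have hd : DifferentiableOn ℂ (fun z : ℂ => z⁻¹ • g z ^ q) (closure U) := by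
      intro z hz
      exact ((differentiableAt_inv (hne0 z hz)).smul ((hgd z).pow q)).differentiableWithinAt
    have h1U : (1 : ℂ) ∈ closure U := subset_closure ⟨by simpa using hσ1, by simp; linarith⟩
    have := SpectrumBound.of_forall_mem_frontier hUb
      (f := fun z : ℂ => z⁻¹ • g z ^ q) hd.diffContOnCl (s := t ^ q / σ) (by positivity) ?_ h1U
    · simpa using this
    · intro z hz
      have hz0 := hne0 z (frontier_subset_closure hz)
      rcases hfr hz with hz' | hz'
      · have h2 := ((hball (y := z) (by simpa [hz'] using hσδ)).pow hq).smul z⁻¹ (inv_ne_zero hz0)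
        refine h2.mono (le_of_eq ?_)
        rw [norm_inv, hz']
        field_simp
      · have h2 := ((hgR z).pow hq).smul z⁻¹ (inv_ne_zero hz0)
        refine h2.mono ?_
        rw [norm_inv, hz', inv_mul_le_iff₀ (by linarith), ← div_le_iff₀ (by positivity)]
        exact le_max_right _ _
  intro z hz
  by_contra! hlt
  -- Taking `q`-th roots, the factor `1 / σ` disappears as `q → ∞`.
  obtain ⟨q, hq⟩ := ((tendsto_pow_atTop_atTop_of_one_lt ((one_lt_div ht).2 hlt)).eventually_gt_atTop
    (1 / σ) |>.and (eventually_gt_atTop 0)).exists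
  have h3 := key q hq.2 (z ^ q) (spectrum.pow_mem_pow _ q hz)
  have h4 := hq.1
  rw [norm_pow] at h3
  rw [div_pow, lt_div_iff₀ (by positivity)] at h4
  have : t ^ q / σ = 1 / σ * t ^ q := by ring
  linarith

end SpectralBound

/-! ### Images of square-zero elements under a spectrally bounded map. -/

section SquareZero

variable {A B : Type*} [CStarAlgebra A] [NormedRing B] [NormedAlgebra ℂ B]

theorem mem_jacobson_of_forall_isUnit {R : Type*} [Ring R] {x : R}
    (h : ∀ y : R, IsUnit (1 - y * x)) : x ∈ Ring.jacobson R := by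
  rw [Ring.jacobson_eq_sInf_isMaximal, Submodule.mem_sInf]
  intro (I : Ideal R) (hI : I.IsMaximal)
  by_contra hx
  obtain ⟨y, i, hi, hyi⟩ := hI.exists_inv hx
  have : 1 - y * x = i := by rw [← hyi]; abel
  exact hI.ne_top (I.eq_top_of_isUnit_mem hi (this ▸ h y))

theorem SpBdd.IsSpectrallyBounded.exists_spectrumBound {T : A →ₗ[ℂ] B}
    (hT : SpBdd.IsSpectrallyBounded T) :
    ∃ M : ℝ, 0 ≤ M ∧ ∀ (x : A) (s : ℝ), 0 ≤ s → SpectrumBound x s →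
      SpectrumBound (T x) (M * s) := by
  obtain ⟨M, hM⟩ := hT
  refine ⟨M, M.2, fun x s hs hx z hz => ?_⟩
  have h1 : (‖z‖₊ : ENNReal) ≤ M * ENNReal.ofReal s :=
    (le_iSup₂ (f := fun (k : ℂ) (_ : k ∈ spectrum ℂ (T x)) => (‖k‖₊ : ENNReal)) z hz).trans
      ((hM x).trans (by gcongr; exact hx.spectralRadius_le))
  rw [← enorm_eq_nnnorm, ← ofReal_norm z, ← ENNReal.ofReal_coe_nnreal,
    ← ENNReal.ofReal_mul (NNReal.coe_nonneg M)] at h1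
  exact (ENNReal.ofReal_le_ofReal_iff (mul_nonneg M.2 hs)).1 h1

theorem spectrumBound_add_smul_of_mul_self_eq_zero {a : A} (ha : a * a = 0) (x : A) (c : ℂ) :
    SpectrumBound (c • a + x) (√(‖x‖ ^ 2 + 2 * ‖c‖ * ‖x‖ * ‖a‖)) := by
  refine SpectrumBound.of_pow (Real.sqrt_nonneg _) two_ne_zero fun z hz => ?_
  rw [Real.sq_sqrt (by positivity)]
  have h1 : (c • a + x) ^ 2 = x * x + c • (a * x + x * a) := by
    rw [pow_two, add_mul, mul_add, mul_add, smul_mul_smul_comm, ha, smul_zero, smul_mul_assoc,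
      mul_smul_comm, smul_add]
    abel
  have hone : ‖(1 : A)‖ ≤ 1 := (IsStarProjection.one A).norm_le
  have h2 := spectrum.norm_le_norm_mul_of_mem hz
  have h3 : ‖(c • a + x) ^ 2‖ ≤ ‖x‖ ^ 2 + 2 * ‖c‖ * ‖x‖ * ‖a‖ := by
    rw [h1]
    calc ‖x * x + c • (a * x + x * a)‖ ≤ ‖x‖ * ‖x‖ + ‖c‖ * (‖a‖ * ‖x‖ + ‖x‖ * ‖a‖) := by
          refine (norm_add_le _ _).trans (add_le_add (norm_mul_le _ _) ?_)
          rw [norm_smul]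
          gcongr
          exact (norm_add_le _ _).trans (add_le_add (norm_mul_le _ _) (norm_mul_le _ _))
      _ = _ := by ring
  nlinarith [norm_nonneg ((c • a + x) ^ 2)]

variable {T : A →ₗ[ℂ] B}

theorem exists_spectrumBound_mul_add_smul [CompleteSpace B] (hT : SpBdd.IsSpectrallyBounded T)
    (hsurj : Function.Surjective T) {a : A} (ha : a * a = 0) (y : B) :
    ∃ R : ℝ, ∀ c : ℂ, SpectrumBound (y * T a + c • T a) R := by
  obtain ⟨M, hM0, hM⟩ := hT.exists_spectrumBound
  obtain ⟨x₁, hx₁⟩ := hsurj (y * y * T a)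
  obtain ⟨x₂, hx₂⟩ := hsurj y
  set b := T a
  set k := ‖x₁‖ + ‖x₂‖
  have hk : 0 ≤ k := by positivity
  -- Beyond `L`, `c - y` is invertible (first two terms) and `M * ‖X‖ ≤ ‖ν‖ / 2` below (last term).
  set L : ℝ := 1 + ‖y‖ * ‖(1 : B)‖ + 4 * M * k
  have hL1 : 1 ≤ L := by simp only [L, add_assoc]; exact le_add_of_nonneg_right (by positivity)
  refine ⟨max ((‖y * b‖ + L * ‖b‖) * ‖(1 : B)‖) (1 + 6 * M ^ 2 * k * ‖a‖), fun c ν hν => ?_⟩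
  rcases le_or_gt ‖c‖ L with hc | hc
  · refine le_max_of_le_left ((spectrum.norm_le_norm_mul_of_mem hν).trans ?_)
    gcongr
    refine (norm_add_le _ _).trans ?_
    rw [norm_smul]
    gcongr
  refine le_max_of_le_right ?_
  have hcpos : 0 < ‖c‖ := by linarith
  have hc0 : c ≠ 0 := norm_pos_iff.1 hcpos
  have hcy : IsUnit (algebraMap ℂ B c - y) := by
    by_contra hcon
    have := spectrum.norm_le_norm_mul_of_mem (spectrum.mem_iff.2 hcon)
    have : 0 ≤ 4 * M * k := by positivity
    linarith
  set X : A := c⁻¹ • (ν • x₂ - x₁)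
  have hTX : T (c • a + X) = c • b + c⁻¹ • (ν • y - y * y * b) := by
    simp only [X, map_add, map_smul, map_sub, hx₁, hx₂, b]
  have hν' : ν ∈ spectrum ℂ (T (c • a + X)) := by
    rw [spectrum.mem_iff] at hν ⊢
    intro hu
    refine hν ?_
    -- Multiplying by the invertible `c - y` cancels the cross terms `c y b`, leaving only an
    -- `O(1/c)` perturbation of `c b`.
    have h1 : (algebraMap ℂ B c - y) * (algebraMap ℂ B ν - (y * b + c • b))
        = Units.mk0 c hc0 • (algebraMap ℂ B ν - T (c • a + X)) := by
      rw [hTX]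
      rw [Units.smul_mk0]
      rw [smul_sub, smul_add, smul_smul c c⁻¹, mul_inv_cancel₀ hc0, one_smul]
      simp only [Algebra.algebraMap_eq_smul_one, sub_mul, mul_sub, mul_add, smul_mul_assoc,
        mul_smul_comm, one_mul, mul_one, smul_sub, mul_assoc, smul_smul]
      rw [mul_comm ν c]
      abel
    have h2 := (isUnit_smul_iff (Units.mk0 c hc0) _).2 hu
    rw [← h1] at h2
    obtain ⟨u, hu'⟩ := hcy
    rw [← hu', Units.isUnit_units_mul] at h2
    exact h2
  have h2 := hM _ _ (Real.sqrt_nonneg _) (spectrumBound_add_smul_of_mul_self_eq_zero ha X c) ν hν'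
  have h3 : ‖ν‖ ^ 2 ≤ M ^ 2 * (‖X‖ ^ 2 + 2 * ‖c‖ * ‖X‖ * ‖a‖) := by
    have := pow_le_pow_left₀ (norm_nonneg ν) h2 2
    rwa [mul_pow, Real.sq_sqrt (by positivity)] at this
  have hX : ‖c‖ * ‖X‖ ≤ k * (‖ν‖ + 1) := by
    rw [norm_smul, norm_inv, mul_inv_cancel_left₀ hcpos.ne']
    refine (norm_sub_le _ _).trans ?_
    rw [norm_smul]
    have := mul_nonneg (norm_nonneg ν) (norm_nonneg x₁)
    simp only [k]
    nlinarith [norm_nonneg x₂]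
  by_contra! hlt
  have hν1 : 1 ≤ ‖ν‖ := by
    have : 0 ≤ 6 * M ^ 2 * k * ‖a‖ := by positivity
    linarith
  have hX2 : k * (‖ν‖ + 1) ≤ k * (2 * ‖ν‖) := by gcongr; linarith
  have hMX : M * ‖X‖ ≤ ‖ν‖ / 2 := by
    have hL2 : 4 * M * k ≤ ‖c‖ := by
      have : 0 ≤ ‖y‖ * ‖(1 : B)‖ := by positivity
      simp only [L] at hc
      linarith
    have h4 : ‖c‖ * (M * ‖X‖) ≤ ‖c‖ * (‖ν‖ / 2) := by
      calc ‖c‖ * (M * ‖X‖) = M * (‖c‖ * ‖X‖) := by ring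
        _ ≤ M * (k * (2 * ‖ν‖)) := mul_le_mul_of_nonneg_left (hX.trans hX2) hM0
        _ = (4 * M * k) * (‖ν‖ / 2) := by ring
        _ ≤ _ := by gcongr
    exact le_of_mul_le_mul_left h4 hcpos
  have h5 : M ^ 2 * ‖X‖ ^ 2 ≤ ‖ν‖ ^ 2 / 4 := by
    have := pow_le_pow_left₀ (by positivity) hMX 2
    rw [mul_pow, div_pow] at this
    linarith
  have h6 : M ^ 2 * (2 * ‖c‖ * ‖X‖ * ‖a‖) ≤ 4 * M ^ 2 * k * ‖a‖ * ‖ν‖ := by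
    calc M ^ 2 * (2 * ‖c‖ * ‖X‖ * ‖a‖) = M ^ 2 * 2 * ‖a‖ * (‖c‖ * ‖X‖) := by ring
      _ ≤ M ^ 2 * 2 * ‖a‖ * (k * (2 * ‖ν‖)) :=
          mul_le_mul_of_nonneg_left (hX.trans hX2) (by positivity)
      _ = _ := by ring
  -- The estimates combine to `‖ν‖² ≤ ‖ν‖² / 4 + 4 M² k ‖a‖ ‖ν‖`, so `‖ν‖ ≤ (16/3) M² k ‖a‖`, whence
  -- the constant `6`.
  nlinarith

theorem isUnit_one_sub_smul_of_mul_self_eq_zero (hT : SpBdd.IsSpectrallyBounded T)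
    {a : A} (ha : a * a = 0) (c : ℂ) : IsUnit (1 - c • T a) := by
  rcases eq_or_ne c 0 with rfl | hc
  · simp
  obtain ⟨M, hM0, hM⟩ := hT.exists_spectrumBound
  have h0 : SpectrumBound a 0 := by simpa using spectrumBound_add_smul_of_mul_self_eq_zero ha 0 1
  have h1 := hM a 0 le_rfl h0
  have h2 : IsUnit (algebraMap ℂ B c⁻¹ - T a) := by
    by_contra hcon
    have := h1 _ (spectrum.mem_iff.2 hcon)
    rw [mul_zero, norm_le_zero_iff] at this
    exact inv_ne_zero hc this
  rw [← isUnit_smul_iff (Units.mk0 c hc), Units.smul_mk0, Algebra.algebraMap_eq_smul_one, smul_sub,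
    smul_smul, mul_inv_cancel₀ hc, one_smul] at h2
  exact h2

variable [CompleteSpace B]

theorem SpectrumBound.mul_add_smul (hT : SpBdd.IsSpectrallyBounded T)
    (hsurj : Function.Surjective T) {a : A} (ha : a * a = 0) {y : B} {s : ℝ} (hs : 0 ≤ s)
    (h : SpectrumBound (y * T a) s) (c : ℂ) : SpectrumBound (y * T a + c • T a) s := by
  obtain ⟨R, hR⟩ := exists_spectrumBound_mul_add_smul hT hsurj ha y
  exact SpectrumBound.liouville (f := fun c : ℂ => y * T a + c • T a) (by fun_prop) hR (z₀ := 0)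
    (by simpa using h) hs c

/-- The element is `y b (1 - c b)`. Multiplying it by the entire function `(1 - z b)⁻¹` gives a
function joining it (`z = 0`) to `y b` (`z = c`), and Liouville compares the two. -/
theorem SpectrumBound.sub_smul_mul (hT : SpBdd.IsSpectrallyBounded T)
    (hsurj : Function.Surjective T) {a : A} (ha : a * a = 0) {y : B} {s : ℝ} (hs : 0 ≤ s)
    (h : SpectrumBound (y * T a) s) (c : ℂ) : SpectrumBound ((y - c • (y * T a)) * T a) s := by
  set b := T a
  have hu := isUnit_one_sub_smul_of_mul_self_eq_zero hT ha
  set y' := y - c • (y * b)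
  obtain ⟨R, hR0, hR⟩ := exists_spectrumBound (y' * b)
  let f : ℂ → B := fun z => y' * b * Ring.inverse (1 - z • b)
  have hf : Differentiable ℂ f := fun z => by
    have h1 : DifferentiableAt ℂ (fun z : ℂ => 1 - z • b) z := by fun_prop
    exact (differentiableAt_const _).mul
      (DifferentiableAt.comp (g := Ring.inverse) z (differentiableAt_inverse (hu z)) h1)
  have hbdd : ∀ z, SpectrumBound (f z) R := by
    intro z μ hμ
    -- `μ - f z` is singular exactly when `μ (1 - z b) - y' b` is, that is, when `μ` is in the
    -- spectrum of `y' b + μ z b`.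
    refine SpectrumBound.mul_add_smul hT hsurj ha hR0 hR (μ * z) μ ?_
    rw [spectrum.mem_iff] at hμ ⊢
    intro hcon
    refine hμ ?_
    obtain ⟨u, hu'⟩ := hu z
    rw [← Units.isUnit_mul_units _ u]
    convert! hcon using 1
    simp only [f]
    rw [← hu', Ring.inverse_unit, sub_mul, mul_assoc, Units.inv_mul, mul_one, hu',
      Algebra.algebraMap_eq_smul_one, smul_mul_assoc, one_mul, smul_sub, smul_smul]
    abel
  have hfc : f c = y * b := by
    have h1 : y' * b = y * b * (1 - c • b) := by
      simp only [y', sub_mul, mul_sub, smul_mul_assoc, mul_smul_comm, mul_one]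
    simp only [f]
    rw [h1, mul_assoc, Ring.mul_inverse_cancel _ (hu c), mul_one]
  have hf0 : f 0 = y' * b := by simp [f]
  rw [← hf0]
  exact SpectrumBound.liouville hf hbdd (by rwa [hfc]) hs 0

/-- A spectrally bounded map onto a semisimple Banach algebra preserves elements of square zero. -/
theorem map_mul_map_eq_zero_of_mul_self_eq_zero (hB : SpBdd.HasZeroRadical B)
    (hT : SpBdd.IsSpectrallyBounded T) (hsurj : Function.Surjective T) {a : A} (ha : a * a = 0) :
    T a * T a = 0 := by
  set b := T a
  suffices h : b * b ∈ Ring.jacobson B by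
    rw [hB] at h
    simpa using h
  refine mem_jacobson_of_forall_isUnit fun y => ?_
  obtain ⟨s, hs, hys⟩ := exists_spectrumBound (y * b)
  have h1 : ∀ z : ℂ, z ≠ 0 → SpectrumBound (y * b * b - z • (y * b)) (‖z‖ * s) := by
    intro z hz
    have := (hys.sub_smul_mul hT hsurj ha hs z⁻¹).smul (-z) (neg_ne_zero.2 hz)
    rw [norm_neg] at this
    convert! this using 1
    rw [sub_mul, smul_sub, smul_mul_assoc, smul_smul, neg_mul, mul_inv_cancel₀ hz]
    simp only [neg_smul, one_smul, b]
    abel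
  -- The value at `z = 0` is bounded by the values on a circle of small radius `r`, which are at
  -- most `r * s`.
  have h2 : SpectrumBound (y * b * b) 0 := by
    refine SpectrumBound.of_forall_gt fun t ht => ?_
    set r : ℝ := t / (s + 1)
    have hr : 0 < r := by positivity
    have hd : Differentiable ℂ fun z : ℂ => y * b * b - z • (y * b) := by fun_prop
    have h3 := SpectrumBound.of_forall_mem_frontier (Metric.isBounded_ball (x := (0 : ℂ)) (r := r))
      hd.diffContOnCl ht.le ?_ (subset_closure (Metric.mem_ball_self hr))
    · simpa using h3
    · intro z hz
      rw [frontier_ball _ hr.ne', mem_sphere_zero_iff_norm] at hz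
      refine (h1 z (norm_pos_iff.1 (hz ▸ hr))).mono ?_
      rw [hz]
      calc r * s ≤ r * (s + 1) := by gcongr; linarith
        _ = t := by simp only [r]; field_simp
  by_contra hcon
  have h3 := h2 1 (by rw [spectrum.mem_iff, map_one, mul_assoc]; exact hcon)
  norm_num at h3

end SquareZero
-- Jordan multiplication by an element with central square.
section JordanIdentity

variable {B : Type*} [Ring B]

/-- If `c²` is central and the Jordan multiplication by `c` is surjective, then `c` is invertible
and central. -/
theorem isUnit_and_central_of_jordan_mul_surjective {c : B} (hc : ∀ b, c * c * b = b * (c * c))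
    (hs : ∀ b, ∃ w, c * w + w * c = b) : IsUnit c ∧ ∀ b, c * b = b * c := by
  have hcuc : ∀ u, c * u * c = c * c * u := by
    intro u
    obtain ⟨w, rfl⟩ := hs u
    calc c * (c * w + w * c) * c = c * c * (w * c) + c * (w * (c * c)) := by noncomm_ring
      _ = c * c * (c * w + w * c) := by rw [← hc w]; noncomm_ring
  obtain ⟨w, hw⟩ := hs 1
  have h1 : c * c * (4 * (w * w)) = 1 := by
    have h2 : (c * w + w * c) * (c * w + w * c) = 1 := by rw [hw, one_mul]
    rw [← h2]
    have e1 := hcuc w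
    have e2 := hcuc (w * w)
    have e3 := hc w
    -- Each of the four copies of `c² w²` becomes one term of the expanded square `(c w + w c)²`.
    calc c * c * (4 * (w * w))
        = c * c * w * w + c * c * (w * w) + c * c * w * w + c * c * w * w := by noncomm_ring
      _ = c * w * c * w + c * (w * w) * c + w * (c * c) * w + w * (c * w * c) := by
          rw [e2, e1, ← mul_assoc w (c * c) w, e3]
      _ = (c * w + w * c) * (c * w + w * c) := by noncomm_ring
  have h2 : 4 * (w * w) * (c * c) = 1 := by rw [← hc, h1]
  have hunit : IsUnit c := by
    rw [isUnit_iff_exists_and_exists]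
    exact ⟨⟨c * (4 * (w * w)), by rw [← mul_assoc, h1]⟩, ⟨4 * (w * w) * c, by rw [mul_assoc, h2]⟩⟩
  refine ⟨hunit, fun b => ?_⟩
  refine hunit.mul_left_cancel ?_
  rw [← mul_assoc, ← mul_assoc, hcuc]

end JordanIdentity

/-! ### Square-zero elements and idempotents. -/

section Idempotents

variable {A : Type*} [CStarAlgebra A]

/-- The linear span of the idempotents similar to a projection. -/
noncomputable def idemSpan (A : Type*) [CStarAlgebra A] : Submodule ℂ A :=
  Submodule.span ℂ {e | ∃ (u : Aˣ) (q : A), IsStarProjection q ∧ e = u * q * (↑u⁻¹ : A)}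

/-- Elements of square zero in the corner `p A p` that lie in the span of the idempotents. -/
def squareZero (p : A) : Set A := {a | p * a = a ∧ a * p = a ∧ a * a = 0 ∧ a ∈ idemSpan A}

theorem conj_mem_idemSpan (u : Aˣ) {a : A} (ha : a ∈ idemSpan A) :
    u * a * (↑u⁻¹ : A) ∈ idemSpan A := by
  induction ha using Submodule.span_induction with
  | mem x hx =>
    obtain ⟨v, q, hq, rfl⟩ := hx
    exact Submodule.subset_span ⟨u * v, q, hq, by simp [mul_assoc]⟩
  | zero => simp
  | add x y _ _ hx hy => simpa [mul_add, add_mul] using add_mem hx hy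
  | smul c x _ hx => simpa using Submodule.smul_mem _ c hx

/-- The unipotent unit `1 + s` for an element `s` of square zero. -/
def oneAddUnit {R : Type*} [Ring R] (s : R) (hs : s * s = 0) : Rˣ where
  val := 1 + s
  inv := 1 - s
  val_inv := by rw [mul_sub, add_mul, add_mul, hs]; noncomm_ring
  inv_val := by rw [mul_add, sub_mul, sub_mul, hs]; noncomm_ring

theorem IsStarProjection.mem_idemSpan {q : A} (hq : IsStarProjection q) : q ∈ idemSpan A :=
  Submodule.subset_span ⟨1, q, hq, by simp⟩

variable {p e f : A}

/-- Since `s e = 0` and `e s = s`, `(1 - s) e (1 + s) = e + s`, so `s` is a difference of two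
idempotents similar to `e`. -/
theorem offDiag_mem_squareZero (he : IsStarProjection e)
    (hpe : p * e = e) (hfp : f * p = f) (hfe : f * e = 0) {s : A}
    (hes : e * s = s) (hsf : s * f = s) : s ∈ squareZero p := by
  have hse : s * e = 0 := by rw [← hsf, mul_assoc, hfe, mul_zero]
  have hss : s * s = 0 := by nth_rw 2 [← hes]; rw [← mul_assoc, hse, zero_mul]
  refine ⟨by rw [← hes, ← mul_assoc, hpe], by rw [← hsf, mul_assoc, hfp], hss, ?_⟩
  have hs' : -s * -s = 0 := by rw [neg_mul_neg, hss]
  have h1 := conj_mem_idemSpan (oneAddUnit (-s) hs') he.mem_idemSpan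
  have h2 : (oneAddUnit (-s) hs' : A) * e * (↑(oneAddUnit (-s) hs')⁻¹ : A) = e + s := by
    show (1 + -s) * e * (1 - -s) = e + s
    have : (1 + -s) * e = e := by rw [add_mul, neg_mul, hse]; simp
    rw [this, sub_neg_eq_add, mul_add, mul_one, hes]
  rw [h2] at h1
  simpa using sub_mem h1 he.mem_idemSpan

/-- Conjugating `t` by `1 + s` keeps its square zero and produces `t + (s t - t s) - s t s`, where
`s t s` is again off-diagonal. -/
theorem commutator_mem_span_squareZero (he : IsStarProjection e) (hf : IsStarProjection f)
    (hpe : p * e = e) (hep : e * p = e) (hpf : p * f = f) (hfp : f * p = f)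
    (hef : e * f = 0) (hfe : f * e = 0) {s t : A}
    (hes : e * s = s) (hsf : s * f = s) (hft : f * t = t) (hte : t * e = t) :
    s * t - t * s ∈ Submodule.span ℂ (squareZero p) := by
  have hs := offDiag_mem_squareZero he hpe hfp hfe hes hsf
  have ht := offDiag_mem_squareZero hf hpf hep hef hft hte
  have hsts := offDiag_mem_squareZero (s := s * t * s) he hpe hfp hfe
    (by rw [← mul_assoc, ← mul_assoc, hes]) (by rw [mul_assoc, hsf])
  have hconj : (1 + s) * t * (1 - s) ∈ squareZero p := by
    refine ⟨?_, ?_, ?_, conj_mem_idemSpan (oneAddUnit s hs.2.2.1) ht.2.2.2⟩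
    · rw [← mul_assoc, ← mul_assoc, mul_add, mul_one, add_mul p, hs.1, ht.1, add_mul 1, one_mul]
    · calc (1 + s) * t * (1 - s) * p = (1 + s) * (t * p) - (1 + s) * t * (s * p) := by
            noncomm_ring
        _ = (1 + s) * t * (1 - s) := by rw [ht.2.1, hs.2.1]; noncomm_ring
    · have h1 : (1 - s) * (1 + s) = 1 := (oneAddUnit s hs.2.2.1).inv_val
      calc (1 + s) * t * (1 - s) * ((1 + s) * t * (1 - s))
          = (1 + s) * t * ((1 - s) * (1 + s)) * t * (1 - s) := by noncomm_ring
        _ = (1 + s) * (t * t) * (1 - s) := by rw [h1]; noncomm_ring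
        _ = 0 := by rw [ht.2.2.1]; simp
  have : s * t - t * s = (1 + s) * t * (1 - s) - t + s * t * s := by noncomm_ring
  rw [this]
  exact add_mem (sub_mem (Submodule.subset_span hconj) (Submodule.subset_span ht))
    (Submodule.subset_span hsts)

end Idempotents

/-! ### Corners of properly infinite projections. -/

section ProperlyInfinite

variable {A : Type*} [CStarAlgebra A]

/-- The two summands have orthogonal ranges and supports. The C⋆-identity reduces to selfadjoint
orthogonal summands, for which the norm of the sum is the maximum. -/
theorem norm_conj_add_conj_le {p v w : A} (hp : IsStarProjection p) (hv : star v * v = p)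
    (hw : star w * w = p) (hvw : star v * w = 0) (x : A) :
    ‖v * x * star v + w * x * star w‖ ≤ ‖x‖ := by
  have hwv : star w * v = 0 := by simpa using congrArg star hvw
  have hcontr : ∀ u : A, star u * u = p → ‖u‖ ≤ 1 := by
    intro u hu
    have h1 : ‖u‖ * ‖u‖ = ‖p‖ := by rw [← CStarRing.norm_star_mul_self, hu]
    have h2 : ‖p‖ ≤ 1 := hp.norm_le
    nlinarith [norm_nonneg u]
  have hle : ∀ u : A, star u * u = p → ∀ y : A, ‖u * y * star u‖ ≤ ‖y‖ := by
    intro u hu y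
    have h1 := hcontr u hu
    calc ‖u * y * star u‖ ≤ ‖u‖ * ‖y‖ * ‖star u‖ :=
          (norm_mul_le _ _).trans (by gcongr; exact norm_mul_le _ _)
      _ ≤ 1 * ‖y‖ * 1 := by rw [norm_star]; gcongr
      _ = ‖y‖ := by ring
  have hpx : ‖star x * p * x‖ ≤ ‖x‖ * ‖x‖ := by
    calc ‖star x * p * x‖ ≤ ‖star x‖ * ‖p‖ * ‖x‖ :=
          (norm_mul_le _ _).trans (by gcongr; exact norm_mul_le _ _)
      _ ≤ ‖x‖ * 1 * ‖x‖ := by rw [norm_star]; gcongr; exact hp.norm_le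
      _ = ‖x‖ * ‖x‖ := by ring
  have hps := hp.isSelfAdjoint.star_eq
  set y := star x * p * x
  have hys : star y = y := by simp [y, mul_assoc, hps]
  have hsq : star (v * x * star v + w * x * star w) * (v * x * star v + w * x * star w)
      = v * y * star v + w * y * star w := by
    simp only [star_add, star_mul, star_star, y]
    calc (v * (star x * star v) + w * (star x * star w)) * (v * x * star v + w * x * star w)
        = v * (star x * (star v * v) * x) * star v + v * star x * (star v * w) * (x * star w)
          + w * star x * (star w * v) * (x * star v)
          + w * (star x * (star w * w) * x) * star w := by noncomm_ring
      _ = _ := by rw [hv, hw, hvw, hwv]; simp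
  have hsa : ∀ u : A, IsSelfAdjoint (u * y * star u) := fun u => by
    simp [IsSelfAdjoint, mul_assoc, hys]
  have hz : ∀ u u' : A, star u * u' = 0 → u * y * star u * (u' * y * star u') = 0 := by
    intro u u' h
    calc _ = u * y * (star u * u') * (y * star u') := by noncomm_ring
      _ = 0 := by rw [h]; simp
  have hmax : ‖v * y * star v + w * y * star w‖ ≤ ‖x‖ * ‖x‖ := by
    rw [IsStarNormal.norm_add_eq_max (hsa v).isStarNormal (hsa w).isStarNormal
      ((hz v w hvw).trans (hz w v hwv).symm) (hz v w hvw)]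
    exact max_le ((hle v hv y).trans hpx) ((hle w hw y).trans hpx)
  rw [← hsq, CStarRing.norm_star_mul_self] at hmax
  exact abs_le_of_sq_le_sq' (by nlinarith) (norm_nonneg _) |>.2

/-- Every element of a properly infinite corner is a sum of two commutators, of a special form. -/
theorem exists_eq_sub_half_conj {p v w : A} (hp : IsStarProjection p) (hv : star v * v = p)
    (hw : star w * w = p) (hvw : star v * w = 0) (hvp : v * p = v) (hwp : w * p = w)
    (hpv : p * v = v) (hpw : p * w = w) {x : A} (hx : p * x * p = x) :
    ∃ d : A, p * d * p = d ∧ x = d - (1 / 2 : ℂ) • (v * d * star v + w * d * star w) := by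
  let Θ : A →L[ℂ] A := LinearMap.mkContinuous
    { toFun := fun d => (1 / 2 : ℂ) • (v * d * star v + w * d * star w)
      map_add' := fun a b => by rw [← smul_add]; congr 1; noncomm_ring
      map_smul' := fun c a => by
        simp only [mul_smul_comm, smul_mul_assoc, ← smul_add, RingHom.id_apply]
        rw [smul_comm] } (1 / 2) (fun d => by
          show ‖(1 / 2 : ℂ) • (v * d * star v + w * d * star w)‖ ≤ _
          rw [norm_smul]
          have := norm_conj_add_conj_le hp hv hw hvw d
          norm_num
          linarith)
  have hΘ : ‖Θ‖ < 1 := (LinearMap.mkContinuous_norm_le _ (by norm_num) _).trans_lt (by norm_num)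
  have hΘd : ∀ d, Θ d = (1 / 2 : ℂ) • (v * d * star v + w * d * star w) := fun d => rfl
  let U := Units.oneSub Θ hΘ
  have hps := hp.isSelfAdjoint.star_eq
  have hsv : star v * p = star v := by simpa [hps] using congrArg star hpv
  have hsw : star w * p = star w := by simpa [hps] using congrArg star hpw
  have hsv' : p * star v = star v := by simpa [hps] using congrArg star hvp
  have hsw' : p * star w = star w := by simpa [hps] using congrArg star hwp
  set d : A := (↑U⁻¹ : A →L[ℂ] A) x
  have hd : d - Θ d = x := by
    have : ((U : A →L[ℂ] A) * (↑U⁻¹ : A →L[ℂ] A)) x = x := by rw [Units.mul_inv]; rfl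
    simpa [U] using this
  -- `1 - Θ` is inverted on all of `A`; since `Θ` commutes with compression by `p`, the solution can
  -- be cut down to the corner.
  refine ⟨p * d * p, ?_, ?_⟩
  · have := hp.isIdempotentElem.eq
    calc p * (p * d * p) * p = (p * p) * d * (p * p) := by noncomm_ring
      _ = _ := by rw [this]
  · have e1 : v * (p * d * p) * star v = p * (v * d * star v) * p := by
      calc v * (p * d * p) * star v = (v * p) * d * (p * star v) := by noncomm_ring
        _ = (p * v) * d * (star v * p) := by rw [hvp, hsv', hpv, hsv]
        _ = _ := by noncomm_ring
    have e2 : w * (p * d * p) * star w = p * (w * d * star w) * p := by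
      calc w * (p * d * p) * star w = (w * p) * d * (p * star w) := by noncomm_ring
        _ = (p * w) * d * (star w * p) := by rw [hwp, hsw', hpw, hsw]
        _ = _ := by noncomm_ring
    nth_rw 1 [← hx, ← hd]
    rw [e1, e2, hΘd, ← add_mul, ← mul_add, ← smul_mul_assoc, ← mul_smul_comm]
    noncomm_ring

/-- Commutators of opposite off-diagonal elements lie in the span `N`. The two copies `e`, `f` of
`p` turn arbitrary commutators of the corner, transported into `e A e` by `v`, into such ones; every
corner element is a sum of two commutators, so `e A e` lies in `N`. The other blocks relative to `e`
and `p - e` follow. -/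
theorem corner_subset_span_squareZero {p : A} (h : SpBdd.IsProperlyInfinite p) {x : A}
    (hx : p * x * p = x) : x ∈ Submodule.span ℂ (squareZero p) := by
  obtain ⟨hp, -, e, f, he, hf, hpe, hpf, hef, ⟨v, hv, hve⟩, ⟨w, hw, hwf⟩⟩ := h
  have hpp := hp.isIdempotentElem.eq
  have hps := hp.isSelfAdjoint.star_eq
  have hes := he.isSelfAdjoint.star_eq
  have hfs := hf.isSelfAdjoint.star_eq
  have hee := he.isIdempotentElem.eq
  have hff := hf.isIdempotentElem.eq
  have hep : e * p = e := by simpa [hps, hes] using congrArg star hpe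
  have hfp : f * p = f := by simpa [hps, hfs] using congrArg star hpf
  have hfe : f * e = 0 := by simpa [hes, hfs] using congrArg star hef
  have hvp : ∀ u : A, star u * u = p → u * p = u := by
    intro u hu
    have h1 : star (u * p - u) * (u * p - u) = 0 := by
      calc star (u * p - u) * (u * p - u)
          = p * (star u * u) * p - p * (star u * u) - (star u * u) * p + star u * u := by
            simp only [star_sub, star_mul, hps]; noncomm_ring
        _ = 0 := by rw [hu, hpp, hpp]; noncomm_ring
    exact sub_eq_zero.1 (CStarRing.star_mul_self_eq_zero_iff _ |>.1 h1)
  have hvp' := hvp v hv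
  have hwp' := hvp w hw
  have hev : e * v = v := by rw [← hve, mul_assoc, hv, hvp']
  have hfw : f * w = w := by rw [← hwf, mul_assoc, hw, hwp']
  have hpv : p * v = v := by rw [← hev, ← mul_assoc, hpe]
  have hpw : p * w = w := by rw [← hfw, ← mul_assoc, hpf]
  have hsve : star v * e = star v := by simpa [hes] using congrArg star hev
  have hswf : star w * f = star w := by simpa [hfs] using congrArg star hfw
  have hsvp : star v * p = star v := by simpa [hps] using congrArg star hpv
  have hpsv : p * star v = star v := by simpa [hps] using congrArg star hvp'
  have hpsw : p * star w = star w := by simpa [hps] using congrArg star hwp'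
  have hvw : star v * w = 0 := by
    rw [← hsve, ← hfw, mul_assoc, ← mul_assoc e, hef, zero_mul, mul_zero]
  set N := Submodule.span ℂ (squareZero p)
  -- `v (a b) v⋆ ≡ w (b a) w⋆`
  have hswap : ∀ a b : A, v * (a * (p * b)) * star v - w * (b * (p * a)) * star w ∈ N := by
    intro a b
    have h1 := commutator_mem_span_squareZero he hf hpe hep hpf hfp hef hfe
      (s := v * a * star w) (t := w * b * star v)
      (by rw [← mul_assoc, ← mul_assoc, hev]) (by rw [mul_assoc, hswf])
      (by rw [← mul_assoc, ← mul_assoc, hfw]) (by rw [mul_assoc, hsve])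
    have e1 : v * a * star w * (w * b * star v) = v * (a * (p * b)) * star v := by
      rw [← hw]; noncomm_ring
    have e2 : w * b * star v * (v * a * star w) = w * (b * (p * a)) * star w := by
      rw [← hv]; noncomm_ring
    rwa [e1, e2] at h1
  have hcomm : ∀ a b : A, v * (a * (p * b) - b * (p * a)) * star v ∈ N := by
    intro a b
    have h1 := hswap a b
    -- Swapping with the unit `p` of the corner moves `b p a` from the `w` copy back to the `v`
    -- copy.
    have h2 := hswap (b * (p * a)) p
    have e1 : v * (b * (p * a) * (p * p)) * star v = v * (b * (p * a)) * star v := by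
      rw [hpp]
      calc v * (b * (p * a) * p) * star v = v * (b * (p * a)) * (p * star v) := by noncomm_ring
        _ = _ := by rw [hpsv]
    have e2 : w * (p * (p * (b * (p * a)))) * star w = w * (b * (p * a)) * star w := by
      calc w * (p * (p * (b * (p * a)))) * star w = w * p * p * (b * (p * a)) * star w := by
            noncomm_ring
        _ = _ := by rw [hwp', hwp']
    rw [e1, e2] at h2
    have := sub_mem h1 h2
    convert! this using 1
    noncomm_ring
  have hcorner : ∀ y : A, p * y * p = y → v * y * star v ∈ N := by
    intro y hy
    obtain ⟨d, hd, hyd⟩ :=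
      exists_eq_sub_half_conj hp hv hw hvw hvp' hwp' hpv hpw hy
    have hdp : d * p = d := by rw [← hd, mul_assoc, hpp]
    have aux : ∀ u : A, star u * u = p → p * u = u → p * star u = star u →
        v * (d - u * d * star u) * star v ∈ N := by
      intro u hu hpu hpsu
      have := hcomm (d * star u) u
      -- `d - u d u⋆` is the commutator of `d u⋆` and `u`, as `u⋆ u = p`.
      have e1 : d * star u * (p * u) - u * (p * (d * star u)) = d - u * d * star u := by
        have hpd : p * d = d := by rw [← hd, ← mul_assoc, ← mul_assoc, hpp]
        rw [hpu, mul_assoc d, hu, hdp, ← mul_assoc p, hpd, mul_assoc]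
      rwa [e1] at this
    have h3 := Submodule.smul_mem N (1 / 2 : ℂ)
      (add_mem (aux v hv hpv hpsv) (aux w hw hpw hpsw))
    have e3 : v * y * star v = (1 / 2 : ℂ) • (v * (d - v * d * star v) * star v
        + v * (d - w * d * star w) * star v) := by
      have : y = (1 / 2 : ℂ) • ((d - v * d * star v) + (d - w * d * star w)) := by
        rw [hyd]; module
      rw [this]
      simp only [mul_smul_comm, smul_mul_assoc, mul_add, add_mul]
    rwa [e3]
  set g := p - e
  have hg : IsStarProjection g := by
    refine ⟨?_, ?_⟩
    · show (p - e) * (p - e) = p - e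
      rw [mul_sub, sub_mul, sub_mul, hpp, hep, hpe, hee]; abel
    · exact hp.isSelfAdjoint.sub he.isSelfAdjoint
  have hpg : p * g = g := by simp only [g, mul_sub, hpp, hpe]
  have hgp : g * p = g := by simp only [g, sub_mul, hpp, hep]
  have heg : e * g = 0 := by simp only [g, mul_sub, hep, hee, sub_self]
  have hge : g * e = 0 := by simp only [g, sub_mul, hpe, hee, sub_self]
  have hgg := hg.isIdempotentElem.eq
  have h1 : e * x * g ∈ N := Submodule.subset_span (offDiag_mem_squareZero he hpe hgp hge
    (by rw [← mul_assoc, ← mul_assoc, hee]) (by rw [mul_assoc, hgg]))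
  have h2 : g * x * e ∈ N := Submodule.subset_span (offDiag_mem_squareZero hg hpg hep heg
    (by rw [← mul_assoc, ← mul_assoc, hgg]) (by rw [mul_assoc, hee]))
  have h3 : e * x * e ∈ N := by
    have := hcorner (star v * x * v) (by
      calc p * (star v * x * v) * p = (p * star v) * x * (v * p) := by noncomm_ring
        _ = _ := by rw [hpsv, hvp'])
    have e1 : v * (star v * x * v) * star v = e * x * e := by rw [← hve]; noncomm_ring
    rwa [e1] at this
  -- Modulo `N`, the block `g x g` equals `v (g x g) v⋆`, which lies in `e A e`.
  have h4 : g * x * g ∈ N := by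
    have h5 := commutator_mem_span_squareZero hg he hpg hgp hpe hep hge heg
      (s := g * x * g * star v) (t := v * g)
      (by simp only [← mul_assoc, hgg]) (by rw [mul_assoc, hsve])
      (by rw [← mul_assoc, hev]) (by rw [mul_assoc, hgg])
    have e1 : g * x * g * star v * (v * g) = g * x * g := by
      calc _ = g * x * (g * (star v * v) * g) := by noncomm_ring
        _ = _ := by rw [hv, hgp, hgg]
    have e2 : v * g * (g * x * g * star v) = v * (g * x * g) * star v := by
      calc _ = v * ((g * g) * x * g) * star v := by noncomm_ring
        _ = _ := by rw [hgg]
    rw [e1, e2] at h5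
    have h6 := hcorner (g * x * g) (by
      calc p * (g * x * g) * p = (p * g) * x * (g * p) := by noncomm_ring
        _ = _ := by rw [hpg, hgp])
    simpa using add_mem h5 h6
  have : x = e * x * e + e * x * g + g * x * e + g * x * g := by
    calc x = (e + g) * x * (e + g) := by rw [show e + g = p by simp [g], hx]
      _ = _ := by noncomm_ring
  rw [this]
  exact add_mem (add_mem (add_mem h3 h1) h2) h4

end ProperlyInfinite

/-! ### The Jordan identity for maps preserving square-zero elements. -/

section Main

variable {A B : Type*} [CStarAlgebra A] [Ring B] [Algebra ℂ B]

/-- The symmetrized product of the values of a linear map. -/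
noncomputable def jordanForm (T : A →ₗ[ℂ] B) : A →ₗ[ℂ] A →ₗ[ℂ] B :=
  (LinearMap.mul ℂ B).compl₁₂ T T + ((LinearMap.mul ℂ B).compl₁₂ T T).flip

variable {T : A →ₗ[ℂ] B}

theorem jordanForm_apply (x y : A) : jordanForm T x y = T x * T y + T y * T x := rfl

theorem jordanForm_comm (x y : A) : jordanForm T x y = jordanForm T y x := by
  rw [jordanForm_apply, jordanForm_apply, add_comm]

theorem jordanForm_self_eq_zero (hT : ∀ a : A, a * a = 0 → T a * T a = 0) {a : A}
    (ha : a * a = 0) : jordanForm T a a = 0 := by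
  rw [jordanForm_apply, hT a ha, add_zero]

theorem jordanForm_eq_zero_of_orthogonal (hT : ∀ a : A, a * a = 0 → T a * T a = 0) {a b : A}
    (ha : a * a = 0) (hb : b * b = 0) (hab : a * b = 0) (hba : b * a = 0) :
    jordanForm T a b = 0 := by
  have h1 := hT (a + b) (by rw [add_mul, mul_add, mul_add, ha, hb, hab, hba]; simp)
  rw [map_add, add_mul, mul_add, mul_add, hT a ha, hT b hb] at h1
  simpa [jordanForm_apply] using h1

theorem mem_span_squareZero_of_mem_corner
    (hinf : ∀ p : A, IsStarProjection p → p ≠ 0 → SpBdd.IsProperlyInfinite p) {p : A}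
    (hp : IsStarProjection p) {x : A} (hx : p * x * p = x) :
    x ∈ Submodule.span ℂ (squareZero p) := by
  rcases eq_or_ne p 0 with rfl | h0
  · rw [← hx]; simp
  · exact corner_subset_span_squareZero (hinf p hp h0) hx

theorem idemSpan_eq_top
    (hinf : ∀ p : A, IsStarProjection p → p ≠ 0 → SpBdd.IsProperlyInfinite p) :
    idemSpan A = ⊤ := by
  refine top_unique fun x _ => ?_
  have h1 := mem_span_squareZero_of_mem_corner hinf (IsStarProjection.one A) (x := x) (by simp)
  exact Submodule.span_le.2 (fun a ha => ha.2.2.2) h1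

/-- After conjugation by `u`, both corners are spanned by square-zero elements; for two orthogonal
ones the sum also squares to zero, and expanding gives anticommuting images. -/
theorem jordanForm_corner_eq_zero
    (hinf : ∀ p : A, IsStarProjection p → p ≠ 0 → SpBdd.IsProperlyInfinite p)
    (hT : ∀ a : A, a * a = 0 → T a * T a = 0) (u : Aˣ) {p : A} (hp : IsStarProjection p)
    {e : A} (he : e = u * p * (↑u⁻¹ : A)) (x y : A) :
    jordanForm T (e * x * e) ((1 - e) * y * (1 - e)) = 0 := by
  have hpp := hp.isIdempotentElem.eq
  have hp1 : IsStarProjection (1 - p) := hp.one_sub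
  have hp1p := hp1.isIdempotentElem.eq
  have key : ∀ a ∈ Submodule.span ℂ (squareZero p), ∀ b ∈ Submodule.span ℂ (squareZero (1 - p)),
      jordanForm T (u * a * (↑u⁻¹ : A)) (u * b * (↑u⁻¹ : A)) = 0 := by
    intro a ha b hb
    induction ha using Submodule.span_induction with
    | mem a ha =>
      induction hb using Submodule.span_induction with
      | mem b hb =>
        have hc : ∀ c d : A, c * d = 0 →
            u * c * (↑u⁻¹ : A) * (u * d * (↑u⁻¹ : A)) = 0 := by
          intro c d hcd
          calc _ = u * c * ((↑u⁻¹ : A) * u) * d * (↑u⁻¹ : A) := by noncomm_ring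
            _ = u * (c * d) * (↑u⁻¹ : A) := by rw [Units.inv_mul]; noncomm_ring
            _ = 0 := by rw [hcd]; simp
        have hp0 : p * (1 - p) = 0 := by rw [mul_sub, mul_one, hpp, sub_self]
        have hp0' : (1 - p) * p = 0 := by rw [sub_mul, one_mul, hpp, sub_self]
        refine jordanForm_eq_zero_of_orthogonal hT (hc _ _ ha.2.2.1) (hc _ _ hb.2.2.1)
          (hc _ _ ?_) (hc _ _ ?_)
        · rw [← ha.2.1, ← hb.1, mul_assoc, ← mul_assoc p, hp0, zero_mul, mul_zero]
        · rw [← hb.2.1, ← ha.1, mul_assoc, ← mul_assoc _ p, hp0', zero_mul, mul_zero]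
      | zero => simp
      | add b c _ _ hb hc => rw [mul_add, add_mul, map_add, hb, hc, add_zero]
      | smul c b _ hb => rw [mul_smul_comm, smul_mul_assoc, map_smul, hb, smul_zero]
    | zero => simp
    | add a c _ _ ha hc => rw [mul_add, add_mul, map_add, LinearMap.add_apply, ha, hc, add_zero]
    | smul c a _ ha =>
      rw [mul_smul_comm, smul_mul_assoc, map_smul, LinearMap.smul_apply, ha, smul_zero]
  have h1 := key (p * ((↑u⁻¹ : A) * x * u) * p)
    (mem_span_squareZero_of_mem_corner hinf hp (by
      calc _ = (p * p) * ((↑u⁻¹ : A) * x * u) * (p * p) := by noncomm_ring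
        _ = _ := by rw [hpp]))
    ((1 - p) * ((↑u⁻¹ : A) * y * u) * (1 - p))
    (mem_span_squareZero_of_mem_corner hinf hp1 (by
      calc _ = ((1 - p) * (1 - p)) * ((↑u⁻¹ : A) * y * u) * ((1 - p) * (1 - p)) := by
            simp only [mul_assoc]
        _ = _ := by rw [hp1p]))
  have he1 : 1 - e = u * (1 - p) * (↑u⁻¹ : A) := by
    rw [mul_sub, sub_mul, mul_one, Units.mul_inv, he]
  rw [he1, he]
  convert! h1 using 2
  · simp only [mul_assoc]
  · simp only [mul_assoc]

/-- Peirce decomposition of `y` relative to `e`: diagonal blocks follow from orthogonality of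
corners, off-diagonal ones by perturbing `e`. -/
theorem jordanForm_idempotent
    (hinf : ∀ p : A, IsStarProjection p → p ≠ 0 → SpBdd.IsProperlyInfinite p)
    (hT : ∀ a : A, a * a = 0 → T a * T a = 0) (u : Aˣ) {p : A} (hp : IsStarProjection p)
    {e : A} (he : e = u * p * (↑u⁻¹ : A)) (y : A) :
    (2 : ℂ) • jordanForm T e y = jordanForm T 1 (e * y + y * e) := by
  have hee : e * e = e := by
    rw [he]
    calc _ = u * p * ((↑u⁻¹ : A) * u) * p * (↑u⁻¹ : A) := by noncomm_ring
      _ = u * (p * p) * (↑u⁻¹ : A) := by rw [Units.inv_mul]; noncomm_ring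
      _ = _ := by rw [hp.isIdempotentElem.eq]
  set g := 1 - e
  have hgg : g * g = g := by simp only [g, mul_sub, sub_mul, mul_one, one_mul, hee]; abel
  have heg : e * g = 0 := by simp only [g, mul_sub, mul_one, hee, sub_self]
  have hge : g * e = 0 := by simp only [g, sub_mul, one_mul, hee, sub_self]
  have horth := jordanForm_corner_eq_zero hinf hT u hp he
  have h1 : ∀ x, jordanForm T 1 (e * x * e) = jordanForm T e (e * x * e) := by
    intro x
    have := horth x 1
    rw [mul_one, hgg, jordanForm_comm] at this
    simp only [g, map_sub, LinearMap.sub_apply] at this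
    exact sub_eq_zero.1 this
  have h2 : ∀ x, jordanForm T e (g * x * g) = 0 := by
    intro x
    have := horth 1 x
    rwa [mul_one, hee] at this
  -- a square-zero perturbation of `e` that is again similar to `p`
  have hpert : ∀ s : A, s * s = 0 → (∃ v : Aˣ, e + s = v * p * (↑v⁻¹ : A)) →
      jordanForm T 1 s = (2 : ℂ) • jordanForm T e s := by
    rintro s hs ⟨v, hv⟩
    have hes : (e + s) * (e + s) = e + s := by
      rw [hv]
      calc _ = v * p * ((↑v⁻¹ : A) * v) * p * (↑v⁻¹ : A) := by noncomm_ring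
        _ = v * (p * p) * (↑v⁻¹ : A) := by rw [Units.inv_mul]; noncomm_ring
        _ = _ := by rw [hp.isIdempotentElem.eq]
    have hes' : (1 - (e + s)) * (1 - (e + s)) = 1 - (e + s) := by
      simp only [mul_sub, sub_mul, mul_one, one_mul, hes]; abel
    -- With `J` the Jordan form, subtracting `J(e, 1 - e) = 0` from `J(e + s, 1 - e - s) = 0` and
    -- using `J(s, s) = 0` leaves `J(1, s) = 2 J(e, s)`.
    have h3 := jordanForm_corner_eq_zero hinf hT v hp hv 1 1
    have h4 := horth 1 1
    rw [mul_one, hes, mul_one, hes'] at h3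
    rw [mul_one, hee, mul_one, hgg] at h4
    have h5 := jordanForm_self_eq_zero hT hs
    simp only [g, map_add, map_sub, LinearMap.add_apply] at h3 h4
    rw [jordanForm_comm 1 s, two_smul]
    rw [jordanForm_comm s e, h5] at h3
    linear_combination (norm := module) h3 - h4
  have h3 : jordanForm T 1 (e * y * g) = (2 : ℂ) • jordanForm T e (e * y * g) := by
    have hs : e * y * g * (e * y * g) = 0 := by
      calc _ = e * y * (g * e) * (y * g) := by noncomm_ring
        _ = 0 := by rw [hge]; simp
    refine hpert _ hs ⟨(oneAddUnit _ hs)⁻¹ * u, ?_⟩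
    rw [mul_inv_rev, inv_inv, Units.val_mul, Units.val_mul]
    show _ = (1 - e * y * g) * u * p * ((↑u⁻¹ : A) * (1 + e * y * g))
    calc e + e * y * g = e + (e * e) * y * g - e * y * (g * e) - e * y * (g * e) * (e * y * g) := by
          rw [hge, hee]; simp
      _ = (1 - e * y * g) * e * (1 + e * y * g) := by noncomm_ring
      _ = (1 - e * y * g) * (u * p * (↑u⁻¹ : A)) * (1 + e * y * g) := by rw [← he]
      _ = _ := by simp only [mul_assoc]
  have h4 : jordanForm T 1 (g * y * e) = (2 : ℂ) • jordanForm T e (g * y * e) := by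
    have hs : g * y * e * (g * y * e) = 0 := by
      calc _ = g * y * (e * g) * (y * e) := by noncomm_ring
        _ = 0 := by rw [heg]; simp
    refine hpert _ hs ⟨oneAddUnit _ hs * u, ?_⟩
    rw [mul_inv_rev, Units.val_mul, Units.val_mul]
    show _ = (1 + g * y * e) * u * p * ((↑u⁻¹ : A) * (1 - g * y * e))
    calc e + g * y * e = e + g * y * (e * e) - (e * g) * y * e - g * y * e * (e * g) * y * e := by
          rw [heg, hee]; simp
      _ = (1 + g * y * e) * e * (1 - g * y * e) := by noncomm_ring
      _ = (1 + g * y * e) * (u * p * (↑u⁻¹ : A)) * (1 - g * y * e) := by rw [← he]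
      _ = _ := by simp only [mul_assoc]
  have hy : y = e * y * e + e * y * g + g * y * e + g * y * g := by simp only [g]; noncomm_ring
  have hey : e * y + y * e = e * y * e + e * y * e + e * y * g + g * y * e := by
    simp only [g]; noncomm_ring
  rw [hey]
  nth_rw 1 [hy]
  simp only [map_add, h1, h2, h3, h4, smul_add, two_smul]
  abel

theorem two_smul_jordanForm
    (hinf : ∀ p : A, IsStarProjection p → p ≠ 0 → SpBdd.IsProperlyInfinite p)
    (hT : ∀ a : A, a * a = 0 → T a * T a = 0) (x y : A) :
    (2 : ℂ) • jordanForm T x y = jordanForm T 1 (x * y + y * x) := by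
  have hx : x ∈ idemSpan A := by rw [idemSpan_eq_top hinf]; trivial
  induction hx using Submodule.span_induction with
  | mem e he =>
    obtain ⟨u, p, hp, he⟩ := he
    exact jordanForm_idempotent hinf hT u hp he y
  | zero => simp
  | add a b _ _ ha hb =>
    rw [map_add, LinearMap.add_apply, smul_add, ha, hb, ← map_add]
    congr 1
    noncomm_ring
  | smul c a _ ha =>
    rw [map_smul, LinearMap.smul_apply, smul_comm, ha, smul_mul_assoc, mul_smul_comm, ← smul_add,
      map_smul]

/-- For an idempotent `e`, `P = T e` and `Q = T (1 - e)` anticommute, so `(T 1)² = P² + Q²`, and `P`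
commutes with `Q²`. -/
theorem map_one_sq_commute
    (hinf : ∀ p : A, IsStarProjection p → p ≠ 0 → SpBdd.IsProperlyInfinite p)
    (hT : ∀ a : A, a * a = 0 → T a * T a = 0) (x : A) :
    T 1 * T 1 * T x = T x * (T 1 * T 1) := by
  have hx : x ∈ idemSpan A := by rw [idemSpan_eq_top hinf]; trivial
  induction hx using Submodule.span_induction with
  | mem e he =>
    obtain ⟨u, p, hp, he⟩ := he
    have hee : e * e = e := by
      rw [he]
      calc _ = u * p * ((↑u⁻¹ : A) * u) * p * (↑u⁻¹ : A) := by noncomm_ring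
        _ = u * (p * p) * (↑u⁻¹ : A) := by rw [Units.inv_mul]; noncomm_ring
        _ = _ := by rw [hp.isIdempotentElem.eq]
    have h1 := jordanForm_corner_eq_zero hinf hT u hp he 1 1
    rw [mul_one, mul_one, hee, show (1 - e) * (1 - e) = 1 - e by
      simp only [mul_sub, sub_mul, mul_one, one_mul, hee]; abel, jordanForm_apply] at h1
    set P := T e
    set Q := T (1 - e)
    have h2 : T 1 = P + Q := by rw [← map_add]; simp
    have h3 : P * Q = -(Q * P) := eq_neg_of_add_eq_zero_left h1
    have h4 : T 1 * T 1 = P * P + Q * Q := by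
      rw [h2, add_mul, mul_add, mul_add, h3]; abel
    rw [h4, add_mul, mul_add, mul_assoc P, mul_assoc Q, ← mul_assoc P Q Q, h3, neg_mul,
      mul_assoc Q P Q, h3, mul_neg, neg_neg]
  | zero => simp
  | add a b _ _ ha hb => rw [map_add, mul_add, add_mul, ha, hb]
  | smul c a _ ha => rw [map_smul, mul_smul_comm, smul_mul_assoc, ha]

end Main

theorem corollary4p2 {A B : Type*} [CStarAlgebra A]
    [NormedRing B] [NormedAlgebra ℂ B] [CompleteSpace B]
    (hB : SpBdd.HasZeroRadical B)
    (hA : SpBdd.RealRankZero A)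
    (hinf : ∀ p : A, IsStarProjection p → p ≠ 0 → SpBdd.IsProperlyInfinite p)
    (T : A →ₗ[ℂ] B) (hT : SpBdd.IsSpectrallyBounded T) (hsurj : Function.Surjective T) :
    IsUnit (T 1) ∧ T 1 ∈ Subalgebra.center ℂ B := by
  have hsq : ∀ a : A, a * a = 0 → T a * T a = 0 := fun a ha =>
    map_mul_map_eq_zero_of_mul_self_eq_zero hB hT hsurj ha
  obtain ⟨u, hu⟩ := hsurj 1
  obtain ⟨h1, h2⟩ := isUnit_and_central_of_jordan_mul_surjective (c := T 1)
    (fun b => by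
      obtain ⟨x, rfl⟩ := hsurj b
      exact map_one_sq_commute hinf hsq x)
    (fun b => by
      obtain ⟨y, rfl⟩ := hsurj b
      -- With `T u = 1` the left side is `4 T y`, so a quarter of `T (u y + y u)` is the required
      -- preimage.
      have h := two_smul_jordanForm hinf hsq u y
      rw [jordanForm_apply u y, hu, one_mul, mul_one, ← two_smul ℂ (T y), smul_smul] at h
      refine ⟨(2 * 2 : ℂ)⁻¹ • T (u * y + y * u), ?_⟩
      rw [mul_smul_comm, smul_mul_assoc, ← smul_add, ← jordanForm_apply, ← h, smul_smul,
        inv_mul_cancel₀ (by norm_num), one_smul])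
  exact ⟨h1, Subalgebra.mem_center_iff.2 fun b => (h2 b).symm⟩
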